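/- \textbf{Theorem.} A \emph{self-similar arc} in $\mathbb{R}^N$ is a set $\Lambda\subset\mathbb{R}^N$ homeomorphic to $[0,1]$ for which there are maps $S_1,\dots,S_\ell:\mathbb{R}^N\to\mathbb{R}^N$ and ratios $r_1,\dots,r_\ell\in(0,1)$ with $|S_i(x)-S_i(y)|=r_i|x-y|$ for all $x,y\in\mathbb{R}^N$, such that $\Lambda=\bigcup_{i=1}^{\ell}S_i(\Lambda)$, the set $S_i(\Lambda)\cap S_j(\Lambda)$ is a singleton if $|i-j|=1$, and $S_i(\Lambda)\cap S_j(\Lambda)=\emptyset$ if $|i-j|>1$. Let $\Lambda\subset\mathbb{R}^N$ be a self-similar arc of Hausdorff dimension $s>1$. Then $\Lambda$ is a strict Whitney set with criticality $s$, that is: (1) $\Lambda$ is connected and there is a $C^1$ function $f:\mathbb{R}^N\to\mathbb{R}$ such that $\nabla f(x)=0$ for every $x\in\Lambda$, while $f$ is not constant on $\Lambda$ and is constant on no non-empty relatively open subset of $\Lambda$; (2) $\mathrm{Cr}(\Lambda)=s$, where $$\mathrm{Cr}(\Lambda)=\sup\{r\in\mathbb{R}:\ \text{there are a non-constant } f:\Lambda\to\mathbb{R}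 \text{ and } M>0 \text{ with } |f(x)-f(y)|\le M|x-y|^r \text{ for all } x,y\in\Lambda\}.$$ -/

import Mathlib

/-- A map of a metric space into itself that multiplies all distances by one ratio `r ∈ (0, 1)`. -/
def IsContractiveSimilitude {X : Type*} [MetricSpace X] (S : X → X) : Prop :=
  ∃ r : ℝ, 0 < r ∧ r < 1 ∧ ∀ x y : X, dist (S x) (S y) = r * dist x y

/-- `K` is the self-similar set (the non-empty compact invariant set) of the finite family `S`
of contractive similitudes. -/
structure IsSelfSimilarSet {X : Type*} [MetricSpace X] {l : ℕ} (S : Fin l → X → X)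
    (K : Set X) : Prop where
  similitude : ∀ i, IsContractiveSimilitude (S i)
  nonempty : K.Nonempty
  isCompact : IsCompact K
  invariant : K = ⋃ i, S i '' K

/-- An arc: a homeomorphic image of `[0, 1]`. -/
def IsArc {X : Type*} [TopologicalSpace X] (A : Set X) : Prop :=
  Nonempty (unitInterval ≃ₜ A)

/-- A self-similar arc: an arc that is the self-similar set of a finite family
`S 0, …, S (l - 1)` of contractive similitudes for which consecutive pieces `S i '' A` meet in
exactly one point and non-consecutive pieces are disjoint. -/
def IsSelfSimilarArc {X : Type*} [MetricSpace X] (A : Set X) : Prop :=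
  IsArc A ∧ ∃ (l : ℕ) (S : Fin l → X → X), IsSelfSimilarSet S A ∧
    (∀ i j : Fin l, (i : ℕ) + 1 = j → ∃ z, S i '' A ∩ S j '' A = {z}) ∧
    (∀ i j : Fin l, (i : ℕ) + 1 < j → S i '' A ∩ S j '' A = ∅)

/-- A Whitney function for `E`: a `C¹` function on `ℝᴺ` whose gradient vanishes at every point of
`E`, but which is not constant on `E`. -/
structure IsWhitneyFunction {N : ℕ} (f : EuclideanSpace ℝ (Fin N) → ℝ)
    (E : Set (EuclideanSpace ℝ (Fin N))) : Prop where
  contDiff : ContDiff ℝ 1 f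
  gradient_eq_zero : ∀ x ∈ E, gradient f x = 0
  nonconstant : ∃ x ∈ E, ∃ y ∈ E, f x ≠ f y

/-- A strict Whitney function for `E`: a Whitney function that is constant on no non-empty
relatively open subset `U ∩ E` of `E`. -/
structure IsStrictWhitneyFunction {N : ℕ} (f : EuclideanSpace ℝ (Fin N) → ℝ)
    (E : Set (EuclideanSpace ℝ (Fin N))) : Prop extends IsWhitneyFunction f E where
  nonconstant_on_open : ∀ U : Set (EuclideanSpace ℝ (Fin N)), IsOpen U → (U ∩ E).Nonempty →
    ∃ x ∈ U ∩ E, ∃ y ∈ U ∩ E, f x ≠ f y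

/-- A strict Whitney set: a connected set with a strict Whitney function. -/
def IsStrictWhitneySet {N : ℕ} (E : Set (EuclideanSpace ℝ (Fin N))) : Prop :=
  IsConnected E ∧ ∃ f : EuclideanSpace ℝ (Fin N) → ℝ, IsStrictWhitneyFunction f E

/-- The exponents `r` for which `E` carries a non-constant real function `f` with
`|f x - f y| ≤ M |x - y| ^ r` on `E`. -/
def holderExponents {X : Type*} [MetricSpace X] (E : Set X) : Set ℝ :=
  {r | ∃ f : E → ℝ, (∃ x y, f x ≠ f y) ∧
    ∃ M : ℝ, 0 < M ∧ ∀ x y : E, |f x - f y| ≤ M * dist x y ^ r}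

/-- The criticality of `E`: the supremum of these exponents, taken in the extended reals, so that
it is a genuine supremum for every `E`. -/
noncomputable def criticality {X : Type*} [MetricSpace X] (E : Set X) : EReal :=
  sSup ((fun r : ℝ => (r : EReal)) '' holderExponents E)

/-! Parametrize the arc by an injective continuous `h` on `[0, 1]`, with ratios `ρ i`, and let `r <
s`. Covering by cylinders shows that `∑ ρ i ^ r ≤ 1` would force dimension at most `r`; hence `∑ ρ i
^ r > 1`. A chain with small jumps between two points must then cross many cylinders, each crossing
being a scaled copy of a shorter chain, so the sum of the `r`-th powers of its steps cannot tend to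
zero (`exists_pos_le_chainCost`).

The infimum of these sums is therefore a genuine metric below `dist ^ r`. Embedding it isometrically
into continuous functions and applying a generic functional gives a nowhere constant function with
Hölder exponent `r` (`exists_holder_nowhere_constant`). For `1 < r < s`, a Whitney-type extension
(`exists_contDiff_extension_fderiv_eq_zero`) makes it `C¹` with vanishing gradient on the arc.
Letting `r` increase to `s` gives the lower bound for the criticality. The upper bound holds because
a non-constant image of a connected set contains an interval, and a Hölder map of order `r` divides
dimension by at least `r` (`le_of_mem_holderExponents`). -/

open Set Function

/-! ### Cylinders of a self-similar arc -/

/-- A family of injective continuous self-maps of `[0, 1]`, each of which scales the metric pulled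
back along `h` by a constant ratio, whose ranges cover `[0, 1]` and pairwise meet in at most one
point. -/
structure IsCylinderFamily {X : Type*} [MetricSpace X] (h : unitInterval → X) {ι : Type}
    (ψ : ι → unitInterval → unitInterval) (ρ : ι → ℝ) : Prop where
  pos : ∀ i, 0 < ρ i
  continuous : ∀ i, Continuous (ψ i)
  injective : ∀ i, Injective (ψ i)
  dist_map : ∀ i s t, dist (h (ψ i s)) (h (ψ i t)) = ρ i * dist (h s) (h t)
  cover : ∀ t, ∃ i s, ψ i s = t
  subsingleton : ∀ i j, i ≠ j → (range (ψ i) ∩ range (ψ j)).Subsingleton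

namespace IsCylinderFamily

variable {X : Type*} [MetricSpace X] {h : unitInterval → X} {ι κ : Type}
  {ψ : ι → unitInterval → unitInterval} {ρ : ι → ℝ}
  {φ : κ → unitInterval → unitInterval} {σ : κ → ℝ}

theorem comp (F : IsCylinderFamily h ψ ρ) (G : IsCylinderFamily h φ σ) :
    IsCylinderFamily h (fun p : ι × κ => ψ p.1 ∘ φ p.2) (fun p => ρ p.1 * σ p.2) where
  pos p := mul_pos (F.pos _) (G.pos _)
  continuous p := (F.continuous _).comp (G.continuous _)
  injective p := (F.injective _).comp (G.injective _)
  dist_map p s t := by simp [F.dist_map, G.dist_map, mul_assoc]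
  cover t := by
    obtain ⟨i, s, rfl⟩ := F.cover t
    obtain ⟨j, s, rfl⟩ := G.cover s
    exact ⟨(i, j), s, rfl⟩
  subsingleton := by
    rintro ⟨i, j⟩ ⟨i', j'⟩ hne
    by_cases hi : i = i'
    · subst hi
      have hj : j ≠ j' := fun e => hne (by rw [e])
      simp only [range_comp]
      rw [← image_inter (F.injective i)]
      exact (G.subsingleton j j' hj).image _
    · exact (F.subsingleton i i' hi).anti
        (inter_subset_inter (range_comp_subset_range _ _) (range_comp_subset_range _ _))

/-- The cylinders of generation `k`. -/
theorem exists_iterate [Fintype ι] (F : IsCylinderFamily h ψ ρ) {q : ℝ} (hq : ∀ i, ρ i ≤ q)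
    (r : ℝ) (k : ℕ) :
    ∃ (κ : Type) (_ : Fintype κ) (φ : κ → unitInterval → unitInterval) (σ : κ → ℝ),
      IsCylinderFamily h φ σ ∧ (∀ j, σ j ≤ q ^ k) ∧ ∑ j, σ j ^ r = (∑ i, ρ i ^ r) ^ k := by
  induction k with
  | zero =>
    refine ⟨Unit, inferInstance, fun _ => id, fun _ => 1, ?_, by simp, by simp⟩
    exact ⟨fun _ => one_pos, fun _ => continuous_id, fun _ => injective_id, by simp,
      fun t => ⟨(), t, rfl⟩, fun i j hij => (hij rfl).elim⟩
  | succ k ih =>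
    obtain ⟨κ, _, φ, σ, G, hσ, hsum⟩ := ih
    refine ⟨κ × ι, inferInstance, _, _, G.comp F, fun p => ?_, ?_⟩
    · rw [pow_succ]
      exact mul_le_mul (hσ _) (hq _) (F.pos _).le ((G.pos p.1).le.trans (hσ _))
    · rw [pow_succ, ← hsum, Fintype.sum_prod_type, Finset.sum_mul_sum]
      exact Finset.sum_congr rfl fun i _ => Finset.sum_congr rfl fun j _ =>
        Real.mul_rpow (G.pos _).le (F.pos _).le

end IsCylinderFamily

/-! ### Chains crossing a subinterval -/

section Topology

variable {X : Type*} [MetricSpace X] {h : unitInterval → X}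

/-- An injective continuous map of `[0, 1]` separates points at distance at least `δ`
uniformly. -/
theorem exists_pos_le_dist_of_le_dist (hc : Continuous h) (hi : Injective h) {δ : ℝ}
    (hδ : 0 < δ) : ∃ c > 0, ∀ s t : unitInterval, δ ≤ dist s t → c ≤ dist (h s) (h t) := by
  have hK : IsCompact {p : unitInterval × unitInterval | δ ≤ dist p.1 p.2} :=
    (isClosed_le continuous_const continuous_dist).isCompact
  rcases eq_empty_or_nonempty {p : unitInterval × unitInterval | δ ≤ dist p.1 p.2} with he | hne
  · refine ⟨1, one_pos, fun s t hst => ?_⟩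
    have : (s, t) ∈ {p : unitInterval × unitInterval | δ ≤ dist p.1 p.2} := hst
    simp [he] at this
  · obtain ⟨p, hp, hmin⟩ := hK.exists_isMinOn hne
      (f := fun p : unitInterval × unitInterval => dist (h p.1) (h p.2)) (by fun_prop)
    refine ⟨dist (h p.1) (h p.2), dist_pos.2 fun e => ?_, fun s t hst => hmin (a := (s, t)) hst⟩
    have : dist p.1 p.2 = 0 := by rw [hi e, dist_self]
    simp only [mem_ofPred_eq] at hp
    linarith

/-- A chain that starts below `p` and ends above `q` contains a subchain in `[p, q]` that starts
below `p'` and ends above `q'`, provided that its jumps into and out of `[p, q]` are small. -/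
theorem exists_crossing_subchain {α : Type*} [LinearOrder α] {p p' q q' : α} (hpq' : p ≤ q)
    (hpq : p' ≤ q) (t : ℕ → α) (n : ℕ) (h0 : t 0 < p) (hn : q < t n)
    (hin : ∀ i < n, t i < p → t (i + 1) ≤ p') (hout : ∀ i < n, q < t (i + 1) → q' ≤ t i) :
    ∃ a m, 0 < a ∧ a + m < n ∧ (∀ i ≤ m, t (a + i) ∈ Icc p q) ∧ t a ≤ p' ∧ q' ≤ t (a + m) := by
  classical
  have hex : ∃ b, q < t b := ⟨n, hn⟩
  -- The subchain lies strictly between the first index `b` above `q` and the last index `a` before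
  -- it below `p`.
  set b := Nat.find hex with hb
  have hbq : q < t b := Nat.find_spec hex
  have hbmin : ∀ i < b, t i ≤ q := fun i hi => not_lt.1 (Nat.find_min hex hi)
  have hbn : b ≤ n := Nat.find_min' hex hn
  rcases Nat.eq_zero_or_pos b with hb0 | hb0
  · rw [hb0] at hbq
    exact absurd (hbq.trans h0) (not_lt.2 hpq')
  · set a := Nat.findGreatest (fun i => t i < p) (b - 1) with ha
    have hap : t a < p := Nat.findGreatest_spec (P := fun i => t i < p) (Nat.zero_le (b - 1)) h0
    have hab : a ≤ b - 1 := Nat.findGreatest_le _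
    have hamax : ∀ i, a < i → i ≤ b - 1 → p ≤ t i := fun i h1 h2 =>
      not_lt.1 (Nat.findGreatest_is_greatest (P := fun i => t i < p) h1 h2)
    have hane : a + 1 ≠ b := by
      intro e
      have := hin a (by omega) hap
      rw [e] at this
      exact absurd (this.trans hpq) (not_le.2 hbq)
    refine ⟨a + 1, b - 1 - (a + 1), by omega, by omega, fun i hi => ?_, hin a (by omega) hap, ?_⟩
    · exact ⟨hamax _ (by omega) (by omega), hbmin _ (by omega)⟩
    · have e : a + 1 + (b - 1 - (a + 1)) = b - 1 := by omega
      rw [e]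
      refine hout _ (by omega) ?_
      rwa [Nat.sub_add_cancel hb0]

/-- A chain with small jumps across the range of an injective continuous self-map `φ` of `[0, 1]`
contains the image under `φ` of a chain between `[0, a]` and `[b, 1]`. -/
theorem exists_pullback_chain {φ : unitInterval → unitInterval} (hφ : Continuous φ)
    (hinj : Injective φ) {a b : unitInterval} (ha : 0 < a) (hb : b < 1) :
    ∃ δ > 0, ∀ (t : ℕ → unitInterval) (n : ℕ), (∀ i < n, dist (t i) (t (i + 1)) < δ) →
      (∀ s, t 0 < φ s) → (∀ s, φ s < t n) →
      ∃ (k m : ℕ) (τ : ℕ → unitInterval), 0 < k ∧ k + m < n ∧ (∀ i ≤ m, φ (τ i) = t (k + i)) ∧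
        ((τ 0 ≤ a ∧ b ≤ τ m) ∨ (b ≤ τ 0 ∧ τ m ≤ a)) := by
  have key : ∀ (p p' q q' : unitInterval), p < p' → q' < q → p' ≤ q →
      ∃ δ > 0, ∀ (t : ℕ → unitInterval) (n : ℕ), (∀ i < n, dist (t i) (t (i + 1)) < δ) →
      t 0 < p → q < t n →
      ∃ k m, 0 < k ∧ k + m < n ∧ (∀ i ≤ m, t (k + i) ∈ Icc p q) ∧ t k ≤ p' ∧ q' ≤ t (k + m) := by
    intro p p' q q' hp hq hpq
    -- A jump shorter than `p' - p` from below `p` cannot pass `p'`; similarly at the other end.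
    refine ⟨min (p' - p) (q - q'), lt_min (sub_pos.2 hp) (sub_pos.2 hq), fun t n hd h0 hn => ?_⟩
    refine exists_crossing_subchain (hp.le.trans hpq) hpq t n h0 hn
      (fun i hi hlt => ?_) fun i hi hlt => ?_
    · by_contra! hlt'
      have := (hd i hi).trans_le (min_le_left _ _)
      rw [Subtype.dist_eq, Real.dist_eq, abs_lt] at this
      have h1 : (t i : ℝ) < p := hlt
      have h2 : (p' : ℝ) < t (i + 1) := hlt'
      linarith [this.1]
    · by_contra! hlt'
      have := (hd i hi).trans_le (min_le_right _ _)
      rw [Subtype.dist_eq, Real.dist_eq, abs_lt] at this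
      have h1 : (t i : ℝ) < q' := hlt'
      have h2 : (q : ℝ) < t (i + 1) := hlt
      linarith [this.1]
  -- A decreasing `φ` reverses the chain, which is why the conclusion allows both directions.
  rcases hφ.strictMono_of_inj hinj with hm | hm
  · obtain ⟨δ, hδ, H⟩ := key (φ 0) (φ a) (φ 1) (φ b) (hm ha) (hm hb) (hm.monotone a.2.2)
    refine ⟨δ, hδ, fun t n hd h0 hn => ?_⟩
    obtain ⟨k, m, hk, hkm, hI, h1, h2⟩ := H t n hd (h0 0) (hn 1)
    have hsurj : ∀ i, ∃ s, i ≤ m → φ s = t (k + i) := fun i => by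
      by_cases hi : i ≤ m
      · obtain ⟨s, -, hs⟩ := intermediate_value_Icc zero_le_one hφ.continuousOn (hI i hi)
        exact ⟨s, fun _ => hs⟩
      · exact ⟨0, fun h => (hi h).elim⟩
    choose τ hτ using hsurj
    refine ⟨k, m, τ, hk, hkm, hτ, Or.inl ⟨?_, ?_⟩⟩
    · rw [← hm.le_iff_le, hτ 0 (Nat.zero_le _)]; exact h1
    · rw [← hm.le_iff_le, hτ m le_rfl]; exact h2
  · obtain ⟨δ, hδ, H⟩ := key (φ 1) (φ b) (φ 0) (φ a) (hm hb) (hm ha) (hm.antitone b.2.1)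
    refine ⟨δ, hδ, fun t n hd h0 hn => ?_⟩
    obtain ⟨k, m, hk, hkm, hI, h1, h2⟩ := H t n hd (h0 1) (hn 0)
    have hsurj : ∀ i, ∃ s, i ≤ m → φ s = t (k + i) := fun i => by
      by_cases hi : i ≤ m
      · obtain ⟨s, -, hs⟩ := intermediate_value_Icc' zero_le_one hφ.continuousOn (hI i hi)
        exact ⟨s, fun _ => hs⟩
      · exact ⟨0, fun h => (hi h).elim⟩
    choose τ hτ using hsurj
    refine ⟨k, m, τ, hk, hkm, hτ, Or.inr ⟨?_, ?_⟩⟩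
    · rw [← hm.le_iff_ge, hτ 0 (Nat.zero_le _)]; exact h1
    · rw [← hm.le_iff_ge, hτ m le_rfl]; exact h2

end Topology

/-! ### Lower bounds for the cost of chains -/

section ChainCost

variable {X : Type*} [MetricSpace X] {h : unitInterval → X} {r : ℝ}

/-- The `r`-cost of the chain `t 0, …, t n` in the metric pulled back along `h`. -/
noncomputable def chainCost (h : unitInterval → X) (r : ℝ) (t : ℕ → unitInterval) (n : ℕ) : ℝ :=
  ∑ i ∈ Finset.range n, dist (h (t i)) (h (t (i + 1))) ^ r

theorem le_chainCost (t : ℕ → unitInterval) {n i : ℕ} (hi : i < n) :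
    dist (h (t i)) (h (t (i + 1))) ^ r ≤ chainCost h r t n :=
  Finset.single_le_sum (f := fun i => dist (h (t i)) (h (t (i + 1))) ^ r)
    (fun _ _ => Real.rpow_nonneg dist_nonneg _) (Finset.mem_range.2 hi)

theorem chainCost_reverse (t : ℕ → unitInterval) (n : ℕ) :
    chainCost h r (fun i => t (n - i)) n = chainCost h r t n := by
  unfold chainCost
  rw [← Finset.sum_range_reflect]
  refine Finset.sum_congr rfl fun i hi => ?_
  have hi := Finset.mem_range.1 hi
  have e1 : n - (n - 1 - i) = i + 1 := by omega
  have e2 : n - (n - 1 - i + 1) = i := by omega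
  beta_reduce
  rw [e1, e2, dist_comm]

/-- The cost of a subchain that is the image of a chain under a map scaling distances. -/
theorem sum_Ico_eq_mul_chainCost {φ : unitInterval → unitInterval} {σ : ℝ} (hσ : 0 < σ)
    (hφ : ∀ s t, dist (h (φ s)) (h (φ t)) = σ * dist (h s) (h t)) {t τ : ℕ → unitInterval}
    {k m : ℕ} (hτ : ∀ i ≤ m, φ (τ i) = t (k + i)) :
    ∑ i ∈ Finset.Ico k (k + m), dist (h (t i)) (h (t (i + 1))) ^ r =
      σ ^ r * chainCost h r τ m := by
  rw [Finset.sum_Ico_eq_sum_range, chainCost, Finset.mul_sum, Nat.add_sub_cancel_left]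
  refine Finset.sum_congr rfl fun i hi => ?_
  have hi := Finset.mem_range.1 hi
  rw [add_assoc, ← hτ i hi.le, ← hτ (i + 1) hi, hφ, Real.mul_rpow hσ.le dist_nonneg]

/-- If disjoint sets of edges are assigned to the members of a finite family, up to edges of zero
cost, then the total cost bounds the sum of the partial costs. -/
theorem sum_sum_le_sum_of_subsingleton {κ : Type*} [Fintype κ] {n : ℕ} {e : ℕ → ℝ}
    (he : ∀ i, 0 ≤ e i) {J : κ → Finset ℕ} (hJ : ∀ j, J j ⊆ Finset.range n)
    (hdisj : ∀ j j' i, j ≠ j' → i ∈ J j → i ∈ J j' → e i = 0) :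
    ∑ j, ∑ i ∈ J j, e i ≤ ∑ i ∈ Finset.range n, e i := by
  classical
  have h1 : ∀ j, ∑ i ∈ J j, e i = ∑ i ∈ Finset.range n, if i ∈ J j then e i else 0 := fun j => by
    rw [← Finset.sum_filter, Finset.filter_mem_eq_inter, Finset.inter_eq_right.2 (hJ j)]
  simp only [h1]
  rw [Finset.sum_comm]
  refine Finset.sum_le_sum fun i _ => ?_
  by_cases hex : ∃ j, i ∈ J j ∧ e i ≠ 0
  · obtain ⟨j, hj, hne⟩ := hex
    rw [Finset.sum_eq_single j]
    · simp [hj]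
    · intro j' _ hj'
      by_cases hm : i ∈ J j'
      · exact absurd (hdisj j' j i hj' hm hj) hne
      · simp [hm]
    · simp
  · push Not at hex
    rw [Finset.sum_eq_zero]
    · exact he i
    · intro j _
      split_ifs with hm
      · exact hex j hm
      · rfl

/-- A family of scaling maps into `(a, b)` with `1 ≤ ∑ σ ^ r` forces a positive lower bound for the
`r`-cost of all chains between `[0, a]` and `[b, 1]`. -/
theorem exists_pos_le_chainCost_of_family (hc : Continuous h) (hi : Injective h) (hr : 0 < r)
    {κ : Type*} [Fintype κ] {φ : κ → unitInterval → unitInterval} {σ : κ → ℝ}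
    {a b : unitInterval} (ha : 0 < a) (hb : b < 1) (hσ : ∀ j, 0 < σ j)
    (hφ : ∀ j, Continuous (φ j)) (hinj : ∀ j, Injective (φ j))
    (hdist : ∀ j s t, dist (h (φ j s)) (h (φ j t)) = σ j * dist (h s) (h t))
    (hsub : ∀ i j, i ≠ j → (range (φ i) ∩ range (φ j)).Subsingleton)
    (hmem : ∀ j s, φ j s ∈ Ioo a b) (hsum : 1 ≤ ∑ j, σ j ^ r) :
    ∃ c > 0, ∀ (n : ℕ) (t : ℕ → unitInterval),
      ((t 0 ≤ a ∧ b ≤ t n) ∨ (b ≤ t 0 ∧ t n ≤ a)) → c ≤ chainCost h r t n := by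
  have hne : Nonempty κ := by
    by_contra hemp
    rw [not_nonempty_iff] at hemp
    simp at hsum
    linarith
  choose δ hδ H using fun j => exists_pullback_chain (hφ j) (hinj j) ha hb
  obtain ⟨j₀, hj₀⟩ := Finite.exists_min δ
  obtain ⟨c, hcpos, hcle⟩ := exists_pos_le_dist_of_le_dist hc hi (hδ j₀)
  -- One long jump already costs `c ^ r`. Without long jumps, `1 ≤ ∑ σ j ^ r` lets the induction
  -- return the same constant, so the bound does not depend on `n`.
  refine ⟨c ^ r, Real.rpow_pos_of_pos hcpos r, fun n => ?_⟩
  induction n using Nat.strong_induction_on with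
  | _ n ih =>
    have forward : ∀ t : ℕ → unitInterval, t 0 ≤ a → b ≤ t n → c ^ r ≤ chainCost h r t n := by
      intro t h0 hn
      by_cases hjump : ∃ i < n, δ j₀ ≤ dist (t i) (t (i + 1))
      · obtain ⟨i, hin, hle⟩ := hjump
        exact (Real.rpow_le_rpow hcpos.le (hcle _ _ hle) hr.le).trans (le_chainCost t hin)
      · push Not at hjump
        -- Every cylinder lies inside `(a, b)` and is crossed; since `k j + m j < n`, the
        -- pulled-back chains are shorter, so induction applies to them.
        choose k m τ hk hkm hτ hcross using fun j => H j t n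
          (fun i hin => (hjump i hin).trans_le (hj₀ j))
          (fun s => h0.trans_lt (hmem j s).1) (fun s => (hmem j s).2.trans_le hn)
        have hle := sum_sum_le_sum_of_subsingleton (n := n)
          (e := fun i => dist (h (t i)) (h (t (i + 1))) ^ r)
          (J := fun j => Finset.Ico (k j) (k j + m j))
          (fun i => Real.rpow_nonneg dist_nonneg _)
          (fun j i hij => by
            have := hkm j
            simp only [Finset.mem_Ico, Finset.mem_range] at hij ⊢
            omega)
          (fun j j' i hjj hij hij' => by
            -- An edge used by two cylinders has both ends in the intersection of their ranges,
            -- which is at most one point; so it has length zero.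
            have hrange : ∀ j i, i ∈ Finset.Ico (k j) (k j + m j) →
                t i ∈ range (φ j) ∧ t (i + 1) ∈ range (φ j) := by
              intro j i hij
              rw [Finset.mem_Ico] at hij
              obtain ⟨d, rfl⟩ := Nat.exists_eq_add_of_le hij.1
              exact ⟨⟨_, hτ j d (by omega)⟩, ⟨_, hτ j (d + 1) (by omega)⟩⟩
            have e := hsub j j' hjj ⟨(hrange j i hij).1, (hrange j' i hij').1⟩
              ⟨(hrange j i hij).2, (hrange j' i hij').2⟩
            rw [← e, dist_self, Real.zero_rpow hr.ne'])
        refine le_trans ?_ hle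
        calc c ^ r ≤ (∑ j, σ j ^ r) * c ^ r :=
              le_mul_of_one_le_left (Real.rpow_nonneg hcpos.le r) hsum
          _ = ∑ j, σ j ^ r * c ^ r := Finset.sum_mul ..
          _ ≤ _ := Finset.sum_le_sum fun j _ => by
              rw [sum_Ico_eq_mul_chainCost (hσ j) (hdist j) (hτ j)]
              exact mul_le_mul_of_nonneg_left
                (ih (m j) (by have := hkm j; have := hk j; omega) (τ j) (hcross j))
                (Real.rpow_nonneg (hσ j).le r)
    rintro t (⟨h0, hn⟩ | ⟨h0, hn⟩)
    · exact forward t h0 hn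
    · rw [← chainCost_reverse]
      exact forward _ (by simpa using hn) (by simpa using h0)

namespace IsCylinderFamily

variable {ι : Type} [Fintype ι] {ψ : ι → unitInterval → unitInterval} {ρ : ι → ℝ}

/-- Every non-degenerate interval contains a cylinder of some generation. -/
theorem exists_range_subset_Ioo (F : IsCylinderFamily h ψ ρ) (hc : Continuous h)
    (hi : Injective h) {q : ℝ} (hq : ∀ i, ρ i ≤ q) (hq1 : q < 1) {a b : unitInterval}
    (hab : a < b) :
    ∃ (φ : unitInterval → unitInterval) (σ : ℝ), 0 < σ ∧ Continuous φ ∧ Injective φ ∧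
      (∀ s t, dist (h (φ s)) (h (φ t)) = σ * dist (h s) (h t)) ∧ ∀ s, φ s ∈ Ioo a b := by
  obtain ⟨m, ham, hmb⟩ := exists_between hab
  obtain ⟨c, hcpos, hcle⟩ := exists_pos_le_dist_of_le_dist hc hi
    (δ := min (m - a) (b - m)) (lt_min (sub_pos.2 ham) (sub_pos.2 hmb))
  obtain ⟨C, hC⟩ := (isCompact_range hc).isBounded.subset_closedBall (h m)
  have hq0 : 0 ≤ q := by
    obtain ⟨i, -⟩ := F.cover 0
    exact (F.pos i).le.trans (hq i)
  have hdiam : ∀ s t, dist (h s) (h t) ≤ 2 * C := fun s t => by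
    have h1 := hC (mem_range_self s)
    have h2 := hC (mem_range_self t)
    rw [Metric.mem_closedBall] at h1 h2
    linarith [dist_triangle_right (h s) (h t) (h m)]
  -- At this generation the cylinder images are too small to contain two points whose parameters are
  -- far apart.
  obtain ⟨k, hk⟩ : ∃ k : ℕ, q ^ k * (2 * C) < c := by
    have := ((tendsto_pow_atTop_nhds_zero_of_lt_one hq0 hq1).mul_const (2 * C))
    rw [zero_mul] at this
    exact (this.eventually_lt_const hcpos).exists
  obtain ⟨κ, _, φ, σ, G, hσ, -⟩ := F.exists_iterate hq 0 k
  obtain ⟨j, s₀, hs₀⟩ := G.cover m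
  refine ⟨φ j, σ j, G.pos j, G.continuous j, G.injective j, G.dist_map j, fun s => ?_⟩
  have hlt : dist (φ j s) m < min ((m : ℝ) - a) (b - m) := by
    by_contra! hge
    have h1 := hcle _ _ hge
    rw [← hs₀, G.dist_map] at h1
    have h2 : σ j * dist (h s) (h s₀) ≤ q ^ k * (2 * C) :=
      mul_le_mul (hσ j) (hdiam _ _) dist_nonneg (pow_nonneg hq0 k)
    linarith
  rw [Subtype.dist_eq, Real.dist_eq, lt_min_iff, abs_lt, abs_lt] at hlt
  exact ⟨Subtype.coe_lt_coe.1 (by linarith [hlt.1.1]), Subtype.coe_lt_coe.1 (by linarith [hlt.2.2])⟩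

/-- If `∑ ρ ^ r > 1`, the `r`-cost of chains between two distinct points is bounded below. -/
theorem exists_pos_le_chainCost (F : IsCylinderFamily h ψ ρ) (hc : Continuous h)
    (hi : Injective h) {q : ℝ} (hq : ∀ i, ρ i ≤ q) (hq1 : q < 1) (hr : 0 < r)
    (hsum : 1 < ∑ i, ρ i ^ r) {a b : unitInterval} (hab : a < b) :
    ∃ c > 0, ∀ (n : ℕ) (t : ℕ → unitInterval), t 0 = a → t n = b → c ≤ chainCost h r t n := by
  obtain ⟨a₀, ha₀, ha₁⟩ := exists_between (zero_lt_one (α := unitInterval))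
  obtain ⟨b₀, hb₀, hb₁⟩ := exists_between ha₁
  obtain ⟨φ, σ, hσ, hφ, hφi, hφd, hφm⟩ := F.exists_range_subset_Ioo hc hi hq hq1 hb₀
  -- Moving the cylinders into `(a₀, b₀)` by `φ` costs a factor `σ ^ r`; the strict inequality `1 <
  -- ∑ ρ i ^ r` compensates for it after `k` generations.
  obtain ⟨k, hk⟩ : ∃ k : ℕ, (σ ^ r)⁻¹ < (∑ i, ρ i ^ r) ^ k := pow_unbounded_of_one_lt _ hsum
  obtain ⟨κ, _, θ, η, G, -, hη⟩ := F.exists_iterate hq r k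
  have hσr : 0 < σ ^ r := Real.rpow_pos_of_pos hσ r
  obtain ⟨c, hcpos, hcle⟩ := exists_pos_le_chainCost_of_family hc hi hr (κ := κ)
    (φ := fun j => φ ∘ θ j) (σ := fun j => σ * η j) ha₀ hb₁
    (fun j => mul_pos hσ (G.pos j)) (fun j => hφ.comp (G.continuous j))
    (fun j => hφi.comp (G.injective j))
    (fun j s t => by simp [hφd, G.dist_map, mul_assoc])
    (fun i j hij => by
      rw [range_comp, range_comp, ← image_inter hφi]
      exact (G.subsingleton i j hij).image _)
    (fun j s => hφm _)
    (by
      simp_rw [fun j => Real.mul_rpow hσ.le (G.pos j).le (z := r)]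
      rw [← Finset.mul_sum, hη, ← mul_inv_cancel₀ hσr.ne']
      exact mul_le_mul_of_nonneg_left hk.le hσr.le)
  -- A cylinder inside `(a, b)` transports the bound for chains from `[0, a₀]` to `[b₀, 1]` to
  -- chains from `a` to `b`.
  obtain ⟨φ', σ', hσ', hφ', hφi', hφd', hφm'⟩ := F.exists_range_subset_Ioo hc hi hq hq1 hab
  obtain ⟨δ, hδ, H⟩ := exists_pullback_chain hφ' hφi' ha₀ hb₁
  obtain ⟨c', hcpos', hcle'⟩ := exists_pos_le_dist_of_le_dist hc hi hδ
  refine ⟨min (c' ^ r) (σ' ^ r * c), lt_min (Real.rpow_pos_of_pos hcpos' r)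
    (mul_pos (Real.rpow_pos_of_pos hσ' r) hcpos), fun n t h0 hn => ?_⟩
  by_cases hjump : ∃ i < n, δ ≤ dist (t i) (t (i + 1))
  · obtain ⟨i, hin, hle⟩ := hjump
    exact (min_le_left _ _).trans
      ((Real.rpow_le_rpow hcpos'.le (hcle' _ _ hle) hr.le).trans (le_chainCost t hin))
  · push Not at hjump
    obtain ⟨k, m, τ, hk, hkm, hτ, hcross⟩ := H t n hjump (fun s => h0.trans_lt (hφm' s).1)
      (fun s => (hφm' s).2.trans_eq hn.symm)
    calc min (c' ^ r) (σ' ^ r * c) ≤ σ' ^ r * c := min_le_right _ _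
      _ ≤ σ' ^ r * chainCost h r τ m :=
        mul_le_mul_of_nonneg_left (hcle m τ hcross) (Real.rpow_nonneg hσ'.le r)
      _ = _ := (sum_Ico_eq_mul_chainCost hσ' hφd' hτ).symm
      _ ≤ _ := Finset.sum_le_sum_of_subset_of_nonneg
        (fun i hi => by simp only [Finset.mem_Ico, Finset.mem_range] at hi ⊢; omega)
        (fun _ _ _ => Real.rpow_nonneg dist_nonneg _)

end IsCylinderFamily

end ChainCost

/-! ### Dimension bound from cylinder covers -/

namespace IsCylinderFamily

variable {X : Type*} [MetricSpace X] {h : unitInterval → X} {ι : Type} [Fintype ι]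
  {ψ : ι → unitInterval → unitInterval} {ρ : ι → ℝ}

/-- The cylinders of generation `k` have mesh at most `q ^ k * C`, and the `r`-th powers of their
diameters sum to at most `C ^ r`, so the `r`-dimensional Hausdorff measure is finite. No separation
of the pieces enters. -/
theorem dimH_range_le (F : IsCylinderFamily h ψ ρ) (hc : Continuous h) {q : ℝ}
    (hq : ∀ i, ρ i ≤ q) (hq1 : q < 1) {r : ℝ} (hr : 0 < r) (hsum : ∑ i, ρ i ^ r ≤ 1) :
    dimH (range h) ≤ ENNReal.ofReal r := by
  borelize X
  obtain ⟨C, hC⟩ := Metric.isBounded_iff.1 (isCompact_range hc).isBounded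
  have hdiam : ∀ s t, dist (h s) (h t) ≤ C := fun s t => hC (mem_range_self s) (mem_range_self t)
  have hC0 : 0 ≤ C := dist_nonneg.trans (hdiam 0 0)
  have hq0 : 0 ≤ q := by
    obtain ⟨i, -⟩ := F.cover 0
    exact (F.pos i).le.trans (hq i)
  choose κ inst φ σ G hσ hs using F.exists_iterate hq r
  have hpiece : ∀ k j, Metric.ediam (h '' range (φ k j)) ≤ ENNReal.ofReal (σ k j * C) := by
    intro k j
    refine Metric.ediam_le ?_
    rintro _ ⟨_, ⟨s, rfl⟩, rfl⟩ _ ⟨_, ⟨t, rfl⟩, rfl⟩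
    rw [edist_dist, (G k).dist_map]
    exact ENNReal.ofReal_le_ofReal (mul_le_mul_of_nonneg_left (hdiam s t) ((G k).pos j).le)
  have hμ := MeasureTheory.Measure.hausdorffMeasure_le_liminf_sum (ι := κ) r (range h)
    (l := Filter.atTop) (fun k => ENNReal.ofReal (q ^ k * C))
    (by
      have := ENNReal.tendsto_ofReal
        ((tendsto_pow_atTop_nhds_zero_of_lt_one hq0 hq1).mul_const C)
      simpa using this)
    (fun k j => h '' range (φ k j))
    (Filter.Eventually.of_forall fun k j => (hpiece k j).trans
      (ENNReal.ofReal_le_ofReal (mul_le_mul_of_nonneg_right (hσ k j) hC0)))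
    (Filter.Eventually.of_forall fun k => by
      rintro _ ⟨t, rfl⟩
      obtain ⟨j, s, rfl⟩ := (G k).cover t
      exact mem_iUnion.2 ⟨j, _, ⟨s, rfl⟩, rfl⟩)
  have hbound : ∀ k, ∑ j, Metric.ediam (h '' range (φ k j)) ^ r ≤ ENNReal.ofReal (C ^ r) := by
    intro k
    calc ∑ j, Metric.ediam (h '' range (φ k j)) ^ r
        ≤ ∑ j, ENNReal.ofReal (σ k j ^ r * C ^ r) := Finset.sum_le_sum fun j _ => by
          rw [← Real.mul_rpow ((G k).pos j).le hC0,
            ← ENNReal.ofReal_rpow_of_nonneg (mul_nonneg ((G k).pos j).le hC0) hr.le]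
          exact ENNReal.rpow_le_rpow (hpiece k j) hr.le
      _ = ENNReal.ofReal ((∑ j, σ k j ^ r) * C ^ r) := by
          rw [Finset.sum_mul, ENNReal.ofReal_sum_of_nonneg]
          exact fun j _ => mul_nonneg (Real.rpow_nonneg ((G k).pos j).le r)
            (Real.rpow_nonneg hC0 r)
      _ ≤ ENNReal.ofReal (C ^ r) := by
          refine ENNReal.ofReal_le_ofReal (mul_le_of_le_one_left (Real.rpow_nonneg hC0 r) ?_)
          rw [hs]
          exact pow_le_one₀ (Finset.sum_nonneg fun i _ => Real.rpow_nonneg (F.pos i).le r) hsum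
  have hfin : MeasureTheory.Measure.hausdorffMeasure r (range h) ≤ ENNReal.ofReal (C ^ r) :=
    hμ.trans ((Filter.liminf_le_liminf (Filter.Eventually.of_forall hbound)).trans
      (Filter.liminf_const _).le)
  exact dimH_le_of_hausdorffMeasure_ne_top (d := r.toNNReal)
    (by rw [Real.coe_toNNReal r hr.le]; exact (hfin.trans_lt ENNReal.ofReal_lt_top).ne)

end IsCylinderFamily

/-! ### Nowhere constant Hölder functions from the chain metric -/

/-- Countably many nonzero vectors are not annihilated by a common functional. -/
theorem exists_dual_forall_ne_zero {V : Type*} [NormedAddCommGroup V] [NormedSpace ℝ V]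
    {ι : Type*} [Countable ι] (v : ι → V) (hv : ∀ i, v i ≠ 0) :
    ∃ L : V →L[ℝ] ℝ, ∀ i, L (v i) ≠ 0 := by
  by_contra! hcon
  -- If every functional killed some `v i`, these closed subspaces would cover the dual. By Baire
  -- one of them is the whole dual, against Hahn–Banach.
  let K : ι → Submodule ℝ (V →L[ℝ] ℝ) := fun i =>
    LinearMap.ker (ContinuousLinearMap.apply ℝ ℝ (v i)).toLinearMap
  have hK : ∀ i L, L ∈ K i ↔ L (v i) = 0 := fun i L => by simp [K]
  obtain ⟨i, hi⟩ := nonempty_interior_of_iUnion_of_closed (f := fun i => (K i : Set (V →L[ℝ] ℝ)))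
    (fun i => (ContinuousLinearMap.apply ℝ ℝ (v i)).isClosed_ker)
    (eq_univ_of_forall fun L => by
      obtain ⟨i, hi⟩ := hcon L
      exact mem_iUnion.2 ⟨i, (hK i L).2 hi⟩)
  have htop := (K i).eq_top_of_nonempty_interior' hi
  obtain ⟨g, -, hg⟩ := exists_dual_vector ℝ (v i) (norm_ne_zero_iff.2 (hv i))
  have : g ∈ K i := htop ▸ Submodule.mem_top
  rw [hK, hg] at this
  exact norm_ne_zero_iff.2 (hv i) (by exact_mod_cast this)

section ChainMetric

variable {X : Type*} [MetricSpace X] {h : unitInterval → X} {r : ℝ}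

/-- Translates the lists over which `PseudoMetricSpace.ofPreNNDist` takes its infimum into indexed
chains. -/
theorem exists_chain_of_list {α : Type*} (d : α → α → NNReal) (l : List α) (x y : α) :
    ∃ (n : ℕ) (t : ℕ → α), t 0 = x ∧ t n = y ∧
      (List.zipWith d (x :: l) (l ++ [y])).sum = ∑ i ∈ Finset.range n, d (t i) (t (i + 1)) := by
  induction l generalizing x with
  | nil => exact ⟨1, fun i => if i = 0 then x else y, by simp, by simp, by simp⟩
  | cons z l ih =>
    obtain ⟨n, t, h0, hn, hs⟩ := ih z
    refine ⟨n + 1, fun i => Nat.casesOn i x t, rfl, hn, ?_⟩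
    rw [Finset.sum_range_succ', List.cons_append, List.zipWith_cons_cons, List.sum_cons, hs,
      add_comm]
    simp [h0]

/-- A metric on `[0, 1]` bounded by the `r`-th power of the metric pulled back along `h`. -/
theorem exists_chain_metric (hr : 0 < r)
    (hpos : ∀ a b : unitInterval, a < b → ∃ c > 0, ∀ (n : ℕ) (t : ℕ → unitInterval),
      t 0 = a → t n = b → c ≤ chainCost h r t n) :
    ∃ D : unitInterval → unitInterval → ℝ, (∀ s t, D s t = D t s) ∧ (∀ s, D s s = 0) ∧
      (∀ s t u, D s u ≤ D s t + D t u) ∧ (∀ s t, s ≠ t → 0 < D s t) ∧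
      ∀ s t, D s t ≤ dist (h s) (h t) ^ r := by
  let d : unitInterval → unitInterval → NNReal := fun s t => nndist (h s) (h t) ^ r
  have hd : ∀ s t, (d s t : ℝ) = dist (h s) (h t) ^ r := fun s t => by simp [d]
  have hself : ∀ s, d s s = 0 := fun s => by simp [d, hr.ne']
  have hcomm : ∀ s t, d s t = d t s := fun s t => by simp [d, nndist_comm]
  let P := PseudoMetricSpace.ofPreNNDist d hself hcomm
  have hlt : ∀ s t, s < t → 0 < P.dist s t := fun s t hst => by
    obtain ⟨c, hc, hle⟩ := hpos s t hst
    refine hc.trans_le ?_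
    have e := PseudoMetricSpace.dist_ofPreNNDist d hself hcomm s t
    change c ≤ P.dist s t
    refine le_of_le_of_eq ?_ e.symm
    rw [← Real.coe_toNNReal c hc.le, NNReal.coe_le_coe]
    refine le_ciInf fun l => ?_
    obtain ⟨n, τ, h0, hn, hs⟩ := exists_chain_of_list d l s t
    rw [hs, ← NNReal.coe_le_coe, Real.coe_toNNReal c hc.le, NNReal.coe_sum]
    simp only [hd]
    exact hle n τ h0 hn
  refine ⟨P.dist, P.dist_comm, P.dist_self, P.dist_triangle, fun s t hst => ?_, fun s t => ?_⟩
  · rcases hst.lt_or_gt with h1 | h1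
    · exact hlt s t h1
    · rw [P.dist_comm]; exact hlt t s h1
  · rw [← hd]
    exact PseudoMetricSpace.dist_ofPreNNDist_le d hself hcomm s t

/-- A metric dominated by `dist (h s) (h t) ^ r` yields a function with the corresponding Hölder
bound that is constant on no non-empty open set. -/
theorem exists_holder_nowhere_constant (hc : Continuous h) (hr : 0 < r)
    (hpos : ∀ a b : unitInterval, a < b → ∃ c > 0, ∀ (n : ℕ) (t : ℕ → unitInterval),
      t 0 = a → t n = b → c ≤ chainCost h r t n) :
    ∃ (g : unitInterval → ℝ) (M : ℝ), 0 < M ∧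
      (∀ s t, |g s - g t| ≤ M * dist (h s) (h t) ^ r) ∧
      ∀ V : Set unitInterval, IsOpen V → V.Nonempty → ∃ s ∈ V, ∃ t ∈ V, g s ≠ g t := by
  obtain ⟨D, hcomm, hself, htri, hDpos, hle⟩ := exists_chain_metric hr hpos
  have habs : ∀ s t u, |D s u - D t u| ≤ D s t := fun s t u => by
    rw [abs_le]
    constructor
    · linarith [htri t s u, hcomm s t]
    · linarith [htri s t u]
  have hcont : ∀ s, Continuous (D s) := fun s => by
    refine continuous_iff_continuousAt.2 fun t => ?_
    refine tendsto_iff_dist_tendsto_zero.2 (squeeze_zero (fun _ => dist_nonneg)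
      (g := fun u => dist (h u) (h t) ^ r) (fun u => ?_) ?_)
    · rw [Real.dist_eq, hcomm s u, hcomm s t]
      exact (habs u t s).trans (hle u t)
    · have : Continuous fun u => dist (h u) (h t) ^ r :=
        (hc.dist continuous_const).rpow_const fun _ => Or.inr hr.le
      simpa [hr.ne'] using this.tendsto t
  -- Kuratowski embedding of `D`. A single function `D s` may be constant on an interval; a generic
  -- functional of `Φ` is not.
  let Φ : unitInterval → C(unitInterval, ℝ) := fun s => ⟨D s, hcont s⟩
  have hΦ : ∀ s t, ‖Φ s - Φ t‖ ≤ D s t := fun s t =>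
    (ContinuousMap.norm_le _ ((abs_nonneg _).trans (habs s t s))).2 fun u => habs s t u
  have hΦne : ∀ s t, s ≠ t → Φ s - Φ t ≠ 0 := fun s t hst e => by
    have := congrArg (fun f : C(unitInterval, ℝ) => f t) e
    simp only [ContinuousMap.sub_apply, ContinuousMap.zero_apply] at this
    have h2 : D s t - D t t = 0 := this
    linarith [hDpos s t hst, hself t]
  obtain ⟨Q, hQc, hQd⟩ := TopologicalSpace.exists_countable_dense unitInterval
  have : Countable {p : Q × Q // (p.1 : unitInterval) ≠ p.2} := by
    have := hQc.to_subtype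
    infer_instance
  obtain ⟨L, hL⟩ := exists_dual_forall_ne_zero
    (fun p : {p : Q × Q // (p.1 : unitInterval) ≠ p.2} => Φ p.1.1 - Φ p.1.2)
    fun p => hΦne _ _ p.2
  refine ⟨fun s => L (Φ s), ‖L‖ + 1, by positivity, fun s t => ?_, fun V hV hne => ?_⟩
  · rw [← map_sub, ← Real.norm_eq_abs]
    have h0 : 0 ≤ D s t := (abs_nonneg _).trans (habs s t s)
    calc ‖L (Φ s - Φ t)‖ ≤ ‖L‖ * ‖Φ s - Φ t‖ := L.le_opNorm _
      _ ≤ ‖L‖ * D s t := by gcongr; exact hΦ s t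
      _ ≤ (‖L‖ + 1) * dist (h s) (h t) ^ r := by
        gcongr
        · linarith
        · exact hle s t
  · obtain ⟨p, hpV, hpQ⟩ := hQd.inter_open_nonempty V hV hne
    -- `[0, 1]` has no isolated points, so `V` contains two distinct points of the dense set, which
    -- `L` separates.
    obtain ⟨u, hu⟩ : (V \ {p}).Nonempty := by
      have h1 : V ∈ nhdsWithin p {p}ᶜ := mem_nhdsWithin_of_mem_nhds (hV.mem_nhds hpV)
      exact Filter.nonempty_of_mem (Filter.inter_mem h1 self_mem_nhdsWithin)
    obtain ⟨p', hpV', hpQ'⟩ := hQd.inter_open_nonempty (V \ {p})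
      (hV.sdiff isClosed_singleton) ⟨u, hu⟩
    refine ⟨p, hpV, p', hpV'.1, fun e => ?_⟩
    refine hL ⟨(⟨p, hpQ⟩, ⟨p', hpQ'⟩), fun e' => hpV'.2 e'.symm⟩ ?_
    simp only [map_sub]
    exact sub_eq_zero.2 e

end ChainMetric

/-! ### Mollification with local derivative bounds -/

section Mollification

open MeasureTheory ContinuousLinearMap

variable {E : Type*} [NormedAddCommGroup E] [NormedSpace ℝ E] [FiniteDimensional ℝ E]
  [MeasurableSpace E] [BorelSpace E]

theorem locallyIntegrable_of_measurable_of_bounded {μ : Measure E} [IsFiniteMeasureOnCompacts μ]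
    {u : E → ℝ} (hu : Measurable u) (hb : ∀ R, ∃ B, ∀ y ∈ Metric.ball (0 : E) R, |u y| ≤ B) :
    LocallyIntegrable u μ := by
  intro x
  obtain ⟨B, hB⟩ := hb (‖x‖ + 1)
  have : ProperSpace E := FiniteDimensional.proper ℝ E
  refine ⟨Metric.ball x 1, Metric.ball_mem_nhds x one_pos, ?_⟩
  refine Measure.integrableOn_of_bounded (M := B) Metric.isBounded_ball.measure_lt_top.ne
    hu.aestronglyMeasurable ?_
  refine (ae_restrict_iff' measurableSet_ball).2 (Filter.Eventually.of_forall fun y hy => ?_)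
  refine hB y ?_
  rw [Metric.mem_ball, dist_zero_right]
  rw [Metric.mem_ball, dist_eq_norm] at hy
  linarith [norm_le_norm_add_norm_sub' y x]

variable (E) in
/-- Mollification at scale `1`: local oscillation of `u` controls `v` and its derivative. -/
theorem exists_mollification_unit :
    ∃ C : ℝ, 0 ≤ C ∧ ∀ u : E → ℝ, Measurable u →
      (∀ R, ∃ B, ∀ y ∈ Metric.ball (0 : E) R, |u y| ≤ B) →
      ∃ v : E → ℝ, ContDiff ℝ 1 v ∧ ∀ (x : E) (c B : ℝ), (∀ y ∈ Metric.ball x 1, |u y - c| ≤ B) →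
        |v x - c| ≤ B ∧ ‖fderiv ℝ v x‖ ≤ C * B := by
  let μ : Measure E := Measure.addHaar
  let φ : ContDiffBump (0 : E) := ⟨1 / 4, 1 / 2, by norm_num, by norm_num⟩
  let w : E → ℝ := φ.normed μ
  have hw : ContDiff ℝ 1 w := φ.contDiff_normed
  have hwc : HasCompactSupport w := φ.hasCompactSupport_normed
  have hsupp : tsupport w ⊆ Metric.ball (0 : E) 1 := by
    have : tsupport w = Metric.closedBall (0 : E) (1 / 2) := φ.tsupport_normed_eq
    rw [this]
    exact Metric.closedBall_subset_ball (by norm_num)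
  have hw1 : ∫ x, w x ∂μ = 1 := φ.integral_normed
  have hdw : Continuous (fderiv ℝ w) := hw.continuous_fderiv one_ne_zero
  have hdwc : HasCompactSupport (fderiv ℝ w) := hwc.fderiv ℝ
  have hint : Integrable (fun t => ‖fderiv ℝ w t‖) μ :=
    (hdw.integrable_of_hasCompactSupport hdwc).norm
  refine ⟨∫ t, ‖fderiv ℝ w t‖ ∂μ, integral_nonneg fun _ => norm_nonneg _, fun u hu hb => ?_⟩
  have hli : LocallyIntegrable u μ := locallyIntegrable_of_measurable_of_bounded hu hb
  refine ⟨convolution w u (lsmul ℝ ℝ) μ, hwc.contDiff_convolution_left _ hw hli,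
    fun x c B hB => ⟨?_, ?_⟩⟩
  · have hB0 : 0 ≤ B := (abs_nonneg _).trans (hB x (Metric.mem_ball_self one_pos))
    have := dist_convolution_le (μ := μ) (f := w) (g := u) (x₀ := x) (z₀ := c) (R := 1) hB0
      ((subset_tsupport w).trans hsupp) (fun y => φ.nonneg_normed y) hw1
      hu.aestronglyMeasurable (fun y hy => by rw [Real.dist_eq]; exact hB y hy)
    rwa [Real.dist_eq] at this
  · have hlc : LocallyIntegrable (fun _ : E => -c) μ := locallyIntegrable_const _
    -- As `w` has integral one, replacing `u` by `u - c` shifts the mollification by a constant. The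
    -- derivative can thus be computed from `u - c`, which is at most `B` in absolute value near
    -- `x`.
    have hsum : ∀ y, convolution w (u + fun _ => -c) (lsmul ℝ ℝ) μ y =
        convolution w u (lsmul ℝ ℝ) μ y + -c := by
      intro y
      have e := (hwc.convolutionExists_left (lsmul ℝ ℝ) hw.continuous hli).distrib_add
        (hwc.convolutionExists_left (lsmul ℝ ℝ) hw.continuous hlc)
      rw [e]
      simp only [Pi.add_apply, add_right_inj]
      simp only [convolution_def, lsmul_apply, smul_eq_mul]
      rw [integral_mul_const, hw1, one_mul]
    have hd := hwc.hasFDerivAt_convolution_left (lsmul ℝ ℝ) hw (hli.add hlc) x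
    have hd' : HasFDerivAt (convolution w u (lsmul ℝ ℝ) μ)
        (convolution (fderiv ℝ w) (u + fun _ => -c) (precompL E (lsmul ℝ ℝ)) μ x) x := by
      have := hd.add_const c
      refine this.congr_of_eventuallyEq (Filter.Eventually.of_forall fun y => ?_)
      simp [hsum]
    rw [hd'.fderiv, convolution_def, ← integral_mul_const]
    refine norm_integral_le_of_norm_le (hint.mul_const B) (Filter.Eventually.of_forall fun t => ?_)
    by_cases ht : t ∈ tsupport w
    · have h1 : |u (x - t) - c| ≤ B := hB _ (by
        have := hsupp ht
        rw [Metric.mem_ball, dist_zero_right] at this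
        simpa [Metric.mem_ball, dist_eq_norm] using this)
      refine opNorm_le_bound _ (mul_nonneg (norm_nonneg _) ((abs_nonneg _).trans h1)) fun z => ?_
      rw [precompL_apply]
      simp only [lsmul_apply, smul_eq_mul, Pi.add_apply, ← sub_eq_add_neg]
      rw [norm_mul, Real.norm_eq_abs (u (x - t) - c)]
      calc ‖fderiv ℝ w t z‖ * |u (x - t) - c| ≤ (‖fderiv ℝ w t‖ * ‖z‖) * B := by
            gcongr
            exact le_opNorm _ _
        _ = _ := by ring
    · have : fderiv ℝ w t = 0 := by
        by_contra hne
        exact ht (support_fderiv_subset ℝ hne)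
      simp [this]

variable (E) in
/-- Mollification at scale `ε`. -/
theorem exists_mollification :
    ∃ C : ℝ, 0 ≤ C ∧ ∀ u : E → ℝ, Measurable u →
      (∀ R, ∃ B, ∀ y ∈ Metric.ball (0 : E) R, |u y| ≤ B) → ∀ ε : ℝ, 0 < ε →
      ∃ v : E → ℝ, ContDiff ℝ 1 v ∧ ∀ (x : E) (c B : ℝ), (∀ y ∈ Metric.ball x ε, |u y - c| ≤ B) →
        |v x - c| ≤ B ∧ ‖fderiv ℝ v x‖ ≤ C * B / ε := by
  obtain ⟨C, hC, H⟩ := exists_mollification_unit E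
  refine ⟨C, hC, fun u hu hb ε hε => ?_⟩
  obtain ⟨v, hv, hvb⟩ := H (fun x => u (ε • x)) (hu.comp (measurable_const_smul ε)) fun R => by
    obtain ⟨B, hB⟩ := hb (ε * R)
    refine ⟨B, fun y hy => hB _ ?_⟩
    rw [Metric.mem_ball, dist_zero_right] at hy ⊢
    rw [norm_smul, Real.norm_of_nonneg hε.le]
    exact mul_lt_mul_of_pos_left hy hε
  refine ⟨fun x => v (ε⁻¹ • x), hv.comp (contDiff_const_smul ε⁻¹), fun x c B hB => ?_⟩
  obtain ⟨h1, h2⟩ := hvb (ε⁻¹ • x) c B fun y hy => hB _ (by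
    rw [Metric.mem_ball, dist_eq_norm] at hy ⊢
    have e : ε • y - x = ε • (y - ε⁻¹ • x) := by rw [smul_sub, smul_inv_smul₀ hε.ne']
    rw [e, norm_smul, Real.norm_of_nonneg hε.le]
    exact mul_lt_of_lt_one_right hε hy)
  refine ⟨h1, ?_⟩
  rw [fderiv_comp_smul, norm_smul, Real.norm_of_nonneg (inv_nonneg.2 hε.le)]
  calc ε⁻¹ * ‖fderiv ℝ v (ε⁻¹ • x)‖ ≤ ε⁻¹ * (C * B) := by gcongr
    _ = _ := by ring

end Mollification

/-! ### Whitney extension with vanishing derivative -/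

section WhitneyExtension

theorem add_rpow_le_two_rpow_mul {a b r : ℝ} (ha : 0 ≤ a) (hb : 0 ≤ b) (hr : 0 ≤ r) :
    (a + b) ^ r ≤ 2 ^ r * (a ^ r + b ^ r) := by
  wlog hab : a ≤ b generalizing a b
  · rw [add_comm a, add_comm (a ^ r)]
    exact this hb ha (le_of_not_ge hab)
  calc (a + b) ^ r ≤ (2 * b) ^ r := Real.rpow_le_rpow (by positivity) (by linarith) hr
    _ = 2 ^ r * b ^ r := Real.mul_rpow zero_le_two hb
    _ ≤ 2 ^ r * (a ^ r + b ^ r) := by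
      gcongr
      linarith [Real.rpow_nonneg ha r]

/-- A function with a Hölder bound of any positive order on `K` has a measurable extension that
satisfies such a bound between points of `K` and arbitrary points. -/
theorem exists_measurable_holder_extension {X : Type*} [PseudoMetricSpace X] [MeasurableSpace X]
    [OpensMeasurableSpace X] {K : Set X} (hK : K.Nonempty) {f : X → ℝ} {M r : ℝ} (hM : 0 ≤ M)
    (hr : 0 ≤ r) (hf : ∀ x ∈ K, ∀ y ∈ K, |f x - f y| ≤ M * dist x y ^ r) :
    ∃ g : X → ℝ, Measurable g ∧ ∀ z ∈ K, ∀ y, |g y - f z| ≤ 2 ^ r * M * dist y z ^ r := by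
  have hKne : Nonempty K := hK.to_subtype
  have hlow : ∀ y : X, ∀ z ∈ K, ∀ x : K,
      f z - 2 ^ r * M * dist y z ^ r ≤ f x + 2 ^ r * M * dist y x ^ r := by
    intro y z hz x
    have h1 := (abs_le.1 (hf x x.2 z hz)).1
    have h2 : dist (x : X) z ^ r ≤ 2 ^ r * (dist y x ^ r + dist y z ^ r) :=
      (Real.rpow_le_rpow dist_nonneg (dist_triangle_left _ _ y) hr).trans
        (add_rpow_le_two_rpow_mul dist_nonneg dist_nonneg hr)
    nlinarith [mul_le_mul_of_nonneg_left h2 hM]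
  have hbdd : ∀ y : X, BddBelow (range fun x : K => f x + 2 ^ r * M * dist y x ^ r) := by
    intro y
    obtain ⟨z, hz⟩ := hK
    refine ⟨f z - 2 ^ r * M * dist y z ^ r, ?_⟩
    rintro _ ⟨x, rfl⟩
    exact hlow y z hz x
  -- McShane's infimum, with the factor `2 ^ r` because `dist ^ r` satisfies the triangle inequality
  -- only up to that factor. As an infimum of continuous functions it is upper semicontinuous, hence
  -- measurable.
  refine ⟨fun y => ⨅ x : K, (f x + 2 ^ r * M * dist y x ^ r), ?_, fun z hz y => ?_⟩
  · refine (upperSemicontinuous_ciInf hbdd fun x => Continuous.upperSemicontinuous ?_).measurable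
    exact continuous_const.add (continuous_const.mul
      ((continuous_id.dist continuous_const).rpow_const fun _ => Or.inr hr))
  · rw [abs_le]
    constructor
    · linarith [le_ciInf (hlow y z hz)]
    · have h1 : (⨅ x : K, (f x + 2 ^ r * M * dist y x ^ r)) ≤ f z + 2 ^ r * M * dist y z ^ r :=
        ciInf_le (hbdd y) ⟨z, hz⟩
      linarith

/-- Whitney's extension theorem for functions of Hölder order `r > 1`, with vanishing
derivative. -/
theorem exists_contDiff_extension_fderiv_eq_zero {E : Type*} [NormedAddCommGroup E]
    [NormedSpace ℝ E] [FiniteDimensional ℝ E] {K : Set E} (hK : K.Nonempty) {f : E → ℝ}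
    {M r : ℝ} (hM : 0 ≤ M) (hr : 1 < r)
    (hf : ∀ x ∈ K, ∀ y ∈ K, |f x - f y| ≤ M * dist x y ^ r) :
    ∃ F : E → ℝ, ContDiff ℝ 1 F ∧ ∀ z ∈ K, F z = f z ∧ fderiv ℝ F z = 0 := by
  borelize E
  have hr0 : 0 < r := one_pos.trans hr
  obtain ⟨z₀, hz₀⟩ := hK
  obtain ⟨g, hgm, hg⟩ := exists_measurable_holder_extension ⟨z₀, hz₀⟩ hM hr0.le hf
  set C := 2 ^ r * M with hCdef
  have hC : 0 ≤ C := by positivity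
  have hgb : ∀ R, ∃ B, ∀ y ∈ Metric.ball (0 : E) R, |g y| ≤ B := fun R => by
    refine ⟨|f z₀| + C * (R + ‖z₀‖) ^ r, fun y hy => ?_⟩
    rw [Metric.mem_ball, dist_zero_right] at hy
    have h1 : dist y z₀ ≤ R + ‖z₀‖ := (dist_le_norm_add_norm y z₀).trans (by linarith)
    have h2 : C * dist y z₀ ^ r ≤ C * (R + ‖z₀‖) ^ r :=
      mul_le_mul_of_nonneg_left (Real.rpow_le_rpow dist_nonneg h1 hr0.le) hC
    have h3 : |g y| ≤ |f z₀| + |g y - f z₀| := by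
      have := abs_add_le (f z₀) (g y - f z₀)
      rwa [add_sub_cancel] at this
    linarith [hg z₀ hz₀ y]
  obtain ⟨A, hA, H⟩ := exists_mollification E
  let ε : ℕ → ℝ := fun j => (1 / 2) ^ j
  have hε : ∀ j, 0 < ε j := fun j => by positivity
  have hεs : ∀ j, ε (j + 1) = ε j / 2 := fun j => by simp only [ε, pow_succ]; ring
  -- Width `2 * ε j` makes the indicator, mollified at scale `ε j`, equal to one on `K` and zero at
  -- distance at least `3 * ε j`.
  let T : ℕ → Set E := fun j => {y | Metric.infDist y K < 2 * ε j}
  have hT : ∀ j, MeasurableSet (T j) := fun j =>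
    (isOpen_lt (Metric.continuous_infDist_pt K) continuous_const).measurableSet
  have hI01 : ∀ j y, |(T j).indicator (fun _ => (1 : ℝ)) y - 0| ≤ 1 := fun j y => by
    by_cases hy : y ∈ T j <;> simp [hy]
  choose G hG hGb using fun j => H g hgm hgb (ε j) (hε j)
  choose χ hχ hχb using fun j => H ((T j).indicator fun _ => 1)
    (measurable_const.indicator (hT j)) (fun R => ⟨1, fun y _ => by simpa using hI01 j y⟩)
    (ε j) (hε j)
  -- Here `4 = 3 + 1`: the cutoff radius plus the mollification radius.
  let B : ℕ → ℝ := fun j => C * (4 * ε j) ^ r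
  have hB : ∀ j, 0 ≤ B j := fun j => mul_nonneg hC (Real.rpow_nonneg (by linarith [hε j]) r)
  have hnear : ∀ j x, ∀ z ∈ K, dist x z < 3 * ε j → ∀ y ∈ Metric.ball x (ε j), |g y - f z| ≤ B j :=
    fun j x z hz hxz y hy => by
      refine (hg z hz y).trans (mul_le_mul_of_nonneg_left
        (Real.rpow_le_rpow dist_nonneg ?_ hr0.le) hC)
      rw [Metric.mem_ball] at hy
      linarith [dist_triangle y x z]
  have hG0 : ∀ j x, ∀ z ∈ K, dist x z < 3 * ε j →
      |G j x - f z| ≤ B j ∧ ‖fderiv ℝ (G j) x‖ ≤ A * B j / ε j := fun j x z hz hxz =>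
    hGb j x (f z) (B j) (hnear j x z hz hxz)
  have hG1 : ∀ j x, ∀ z ∈ K, dist x z < 3 * ε j →
      |G (j + 1) x - f z| ≤ B j ∧ ‖fderiv ℝ (G (j + 1)) x‖ ≤ A * B j / ε (j + 1) :=
    fun j x z hz hxz => hGb (j + 1) x (f z) (B j) fun y hy =>
      hnear j x z hz hxz y (Metric.ball_subset_ball (by linarith [hεs j, hε j]) hy)
  have hχ1 : ∀ j x, |χ j x| ≤ 1 ∧ ‖fderiv ℝ (χ j) x‖ ≤ A / ε j := fun j x => by
    have := hχb j x 0 1 fun y _ => hI01 j y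
    rwa [sub_zero, mul_one] at this
  have hχfar : ∀ j x, 3 * ε j ≤ Metric.infDist x K → χ j x = 0 ∧ fderiv ℝ (χ j) x = 0 := by
    intro j x hx
    obtain ⟨h1, h2⟩ := hχb j x 0 0 fun y hy => by
      have : y ∉ T j := fun hyT => by
        have h3 : Metric.infDist y K < 2 * ε j := hyT
        rw [Metric.mem_ball, dist_comm] at hy
        linarith [Metric.infDist_le_infDist_add_dist (s := K) (x := x) (y := y)]
      simp [this]
    constructor
    · simpa using h1
    · simpa using h2
  have hχK : ∀ j, ∀ z ∈ K, χ j z = 1 ∧ fderiv ℝ (χ j) z = 0 := by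
    intro j z hz
    obtain ⟨h1, h2⟩ := hχb j z 1 0 fun y hy => by
      have : y ∈ T j := by
        rw [Metric.mem_ball] at hy
        have h3 : Metric.infDist y K < 2 * ε j := by
          linarith [Metric.infDist_le_dist_of_mem (x := y) hz, hε j]
        exact h3
      simp [this]
    constructor
    · have := abs_nonpos_iff.1 h1
      linarith
    · simpa using h2
  -- The extension is `G 0 + ∑ τ j`. On `K` the cutoffs are one and the sum telescopes to `lim G j =
  -- f`, with derivatives tending to zero; elsewhere a term survives only near `K`, where both
  -- mollifications are close to one value of `f`.
  let τ : ℕ → E → ℝ := fun j x => χ j x * (G (j + 1) x - G j x)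
  let τ' : ℕ → E → E →L[ℝ] ℝ := fun j x =>
    χ j x • (fderiv ℝ (G (j + 1)) x - fderiv ℝ (G j) x) + (G (j + 1) x - G j x) • fderiv ℝ (χ j) x
  have hGd : ∀ j, Differentiable ℝ (G j) := fun j => (hG j).differentiable one_ne_zero
  have hχd : ∀ j, Differentiable ℝ (χ j) := fun j => (hχ j).differentiable one_ne_zero
  have hτd : ∀ j x, HasFDerivAt (τ j) (τ' j x) x := fun j x =>
    (hχd j x).hasFDerivAt.mul ((hGd (j + 1) x).hasFDerivAt.sub (hGd j x).hasFDerivAt)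
  have hτb : ∀ j x, ‖τ' j x‖ ≤ 5 * A * (B j / ε j) := by
    intro j x
    have hnn : 0 ≤ 5 * A * (B j / ε j) := by have := hB j; have := hε j; positivity
    by_cases hx : 3 * ε j ≤ Metric.infDist x K
    · simpa [τ', hχfar j x hx] using hnn
    · obtain ⟨z, hz, hxz⟩ := (Metric.infDist_lt_iff ⟨z₀, hz₀⟩).1 (not_le.1 hx)
      obtain ⟨a1, a2⟩ := hG0 j x z hz hxz
      obtain ⟨b1, b2⟩ := hG1 j x z hz hxz
      obtain ⟨c1, c2⟩ := hχ1 j x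
      have hdiff : ‖G (j + 1) x - G j x‖ ≤ 2 * B j := by
        rw [Real.norm_eq_abs]
        rw [abs_sub_comm] at a1
        linarith [abs_sub_le (G (j + 1) x) (f z) (G j x)]
      have e1 : A * B j / ε (j + 1) = 2 * A * (B j / ε j) := by
        rw [hεs]; have := (hε j).ne'; field_simp
      calc ‖τ' j x‖ ≤ ‖χ j x‖ * ‖fderiv ℝ (G (j + 1)) x - fderiv ℝ (G j) x‖ +
            ‖G (j + 1) x - G j x‖ * ‖fderiv ℝ (χ j) x‖ := by
              refine (norm_add_le _ _).trans ?_
              rw [norm_smul, norm_smul]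
        _ ≤ 1 * (2 * A * (B j / ε j) + A * B j / ε j) + 2 * B j * (A / ε j) := by
            have := hB j
            gcongr
            · exact c1
            · exact (norm_sub_le _ _).trans (add_le_add (e1 ▸ b2) a2)
        _ = 5 * A * (B j / ε j) := by ring
  have hrpow : ∀ j, B j = C * 4 ^ r * ((1 / 2 : ℝ) ^ r) ^ j := fun j => by
    simp only [B, ε]
    rw [Real.mul_rpow (by norm_num) (by positivity), ← Real.rpow_natCast_mul (by norm_num),
      ← Real.rpow_mul_natCast (by norm_num), mul_comm (j : ℝ) r]
    ring
  have hBε : ∀ j, B j / ε j = C * 4 ^ r * ((1 / 2 : ℝ) ^ (r - 1)) ^ j := fun j => by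
    rw [hrpow, Real.rpow_sub_one (by norm_num), div_pow]
    ring
  have hBsum : Summable B := by
    rw [show B = _ from funext hrpow]
    exact (summable_geometric_of_lt_one (by positivity)
      (Real.rpow_lt_one (by norm_num) (by norm_num) hr0)).mul_left _
  -- The derivative bounds are geometric with ratio `(1 / 2) ^ (r - 1)`; their summability requires
  -- `r > 1`.
  have hBεsum : Summable fun j => B j / ε j := by
    simp only [hBε]
    exact (summable_geometric_of_lt_one (by positivity)
      (Real.rpow_lt_one (by norm_num) (by norm_num) (by linarith))).mul_left _
  have hself : ∀ j, ∀ z : E, dist z z < 3 * ε j := fun j z => by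
    rw [dist_self]; linarith [hε j]
  have hτK : ∀ z ∈ K, HasSum (fun j => τ j z) (f z - G 0 z) := by
    intro z hz
    have hs : Summable fun j => τ j z := by
      refine Summable.of_norm_bounded (hBsum.mul_left 2) fun j => ?_
      simp only [τ, (hχK j z hz).1, one_mul]
      have a1 := (hG0 j z z hz (hself j z)).1
      have b1 := (hG1 j z z hz (hself j z)).1
      rw [Real.norm_eq_abs]
      rw [abs_sub_comm] at a1
      linarith [abs_sub_le (G (j + 1) z) (f z) (G j z)]
    refine (hs.hasSum_iff_tendsto_nat).2 ?_
    simp only [τ, (hχK _ z hz).1, one_mul, Finset.sum_range_sub (fun j => G j z)]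
    refine Filter.Tendsto.sub_const ?_ _
    refine tendsto_iff_dist_tendsto_zero.2 (squeeze_zero (fun _ => dist_nonneg) (fun j => ?_)
      hBsum.tendsto_atTop_zero)
    rw [Real.dist_eq]
    exact (hG0 j z z hz (hself j z)).1
  have hsum' : Summable fun j => 5 * A * (B j / ε j) := hBεsum.mul_left _
  have hτK' : ∀ z ∈ K, HasSum (fun j => τ' j z) (0 - fderiv ℝ (G 0) z) := by
    intro z hz
    have hs : Summable fun j => τ' j z := Summable.of_norm_bounded hsum' fun j => hτb j z
    refine (hs.hasSum_iff_tendsto_nat).2 ?_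
    simp only [τ', (hχK _ z hz).1, (hχK _ z hz).2, one_smul, smul_zero, add_zero,
      Finset.sum_range_sub (fun j => fderiv ℝ (G j) z)]
    refine Filter.Tendsto.sub_const ?_ _
    refine squeeze_zero_norm (fun j => (hG0 j z z hz (hself j z)).2) ?_
    have := hBεsum.tendsto_atTop_zero.const_mul A
    simpa [mul_div_assoc] using this
  have hF : ∀ x, HasFDerivAt (fun x => G 0 x + ∑' j, τ j x)
      (fderiv ℝ (G 0) x + ∑' j, τ' j x) x := fun x =>
    (hGd 0 x).hasFDerivAt.add
      (hasFDerivAt_tsum hsum' hτd hτb (hτK z₀ hz₀).summable x)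
  refine ⟨fun x => G 0 x + ∑' j, τ j x, ?_, fun z hz => ⟨?_, ?_⟩⟩
  · refine contDiff_one_iff_fderiv.2 ⟨fun x => (hF x).differentiableAt, ?_⟩
    rw [funext fun x => (hF x).fderiv]
    refine ((hG 0).continuous_fderiv one_ne_zero).add (continuous_tsum (fun j => ?_) hsum' hτb)
    exact ((hχ j).continuous.smul (((hG (j + 1)).continuous_fderiv one_ne_zero).sub
      ((hG j).continuous_fderiv one_ne_zero))).add
      (((hG (j + 1)).continuous.sub (hG j).continuous).smul
        ((hχ j).continuous_fderiv one_ne_zero))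
  · simp only [(hτK z hz).tsum_eq, add_sub_cancel]
  · rw [(hF z).fderiv, (hτK' z hz).tsum_eq, add_sub_cancel]

end WhitneyExtension

/-! ### Self-similar arcs and criticality -/

section SelfSimilarArc

variable {X : Type*} [MetricSpace X] {Λ : Set X}

/-- The cylinder family of a self-similar arc in a parametrization by `[0, 1]`. -/
theorem IsSelfSimilarArc.exists_isCylinderFamily (hΛ : IsSelfSimilarArc Λ) :
    ∃ (e : unitInterval ≃ₜ Λ) (ι : Type) (_ : Fintype ι) (ψ : ι → unitInterval → unitInterval)
      (ρ : ι → ℝ) (q : ℝ), IsCylinderFamily (fun t => (e t : X)) ψ ρ ∧ (∀ i, ρ i ≤ q) ∧ q < 1 := by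
  obtain ⟨⟨e⟩, l, S, hS, hadj, hdisj⟩ := hΛ
  choose ρ hρ0 hρ1 hρ using hS.similitude
  have hmem : ∀ i t, S i (e t) ∈ Λ := fun i t =>
    hS.invariant.ge (mem_iUnion.2 ⟨i, e t, (e t).2, rfl⟩)
  let ψ : Fin l → unitInterval → unitInterval := fun i t => e.symm ⟨S i (e t), hmem i t⟩
  have hψ : ∀ i t, (e (ψ i t) : X) = S i (e t) := fun i t => by simp [ψ]
  have hScont : ∀ i, Continuous (S i) := fun i =>
    (LipschitzWith.of_dist_le_mul (K := ⟨ρ i, (hρ0 i).le⟩) fun x y => (hρ i x y).le).continuous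
  have hSinj : ∀ i, Injective (S i) := fun i x y hxy => by
    have := hρ i x y
    rw [hxy, dist_self, eq_comm, mul_eq_zero] at this
    exact dist_eq_zero.1 (this.resolve_left (hρ0 i).ne')
  have hcover : ∀ t, ∃ i s, ψ i s = t := fun t => by
    have ht : (e t : X) ∈ ⋃ i, S i '' Λ := hS.invariant.le (e t).2
    obtain ⟨i, x, hx, hxt⟩ := mem_iUnion.1 ht
    refine ⟨i, e.symm ⟨x, hx⟩, e.injective (Subtype.ext ?_)⟩
    rw [hψ, e.apply_symm_apply, hxt]
  have hlt : ∀ i j, i < j → (S i '' Λ ∩ S j '' Λ).Subsingleton := fun i j hij => by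
    rcases (Nat.succ_le_of_lt (Fin.lt_def.1 hij)).eq_or_lt with h1 | h1
    · obtain ⟨z, hz⟩ := hadj i j h1
      rw [hz]
      exact subsingleton_singleton
    · rw [hdisj i j h1]
      exact subsingleton_empty
  have hsub : ∀ i j, i ≠ j → (S i '' Λ ∩ S j '' Λ).Subsingleton := fun i j hij => by
    rcases hij.lt_or_gt with h1 | h1
    · exact hlt i j h1
    · rw [inter_comm]
      exact hlt j i h1
  have hne : Nonempty (Fin l) := ⟨(hcover 0).choose⟩
  obtain ⟨i₀, hi₀⟩ := Finite.exists_max ρ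
  refine ⟨e, Fin l, inferInstance, ψ, ρ, ρ i₀, ?_, hi₀, hρ1 i₀⟩
  refine ⟨hρ0, fun i => ?_, fun i s t hst => ?_, fun i s t => ?_, hcover, fun i j hij => ?_⟩
  · exact e.symm.continuous.comp
      (((hScont i).comp (continuous_subtype_val.comp e.continuous)).subtype_mk _)
  · have h1 : S i (e s) = S i (e t) := by rw [← hψ, ← hψ, hst]
    exact e.injective (Subtype.ext (hSinj i h1))
  · rw [hψ, hψ, hρ]
  · rintro _ ⟨⟨s, rfl⟩, ⟨s', hs'⟩⟩ _ ⟨⟨t, rfl⟩, ⟨t', ht'⟩⟩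
    refine e.injective (Subtype.ext (hsub i j hij ⟨?_, ?_⟩ ⟨?_, ?_⟩))
    · exact ⟨e s, (e s).2, (hψ i s).symm⟩
    · exact ⟨e s', (e s').2, by rw [← hs', hψ]⟩
    · exact ⟨e t, (e t).2, (hψ i t).symm⟩
    · exact ⟨e t', (e t').2, by rw [← ht', hψ]⟩

/-- Below its Hausdorff dimension, a self-similar arc carries nowhere constant functions with a
Hölder bound of any given order. -/
theorem IsSelfSimilarArc.exists_holder_nowhere_constant (hΛ : IsSelfSimilarArc Λ) {r : ℝ}
    (hr : 0 < r) (hdim : ENNReal.ofReal r < dimH Λ) :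
    ∃ (f : Λ → ℝ) (M : ℝ), 0 < M ∧ (∀ x y, |f x - f y| ≤ M * dist x y ^ r) ∧
      ∀ V : Set Λ, IsOpen V → V.Nonempty → ∃ x ∈ V, ∃ y ∈ V, f x ≠ f y := by
  obtain ⟨e, ι, _, ψ, ρ, q, F, hq, hq1⟩ := hΛ.exists_isCylinderFamily
  have hc : Continuous fun t => (e t : X) := continuous_subtype_val.comp e.continuous
  have hi : Injective fun t => (e t : X) := Subtype.val_injective.comp e.injective
  have hrange : range (fun t => (e t : X)) = Λ := by
    change range (Subtype.val ∘ e) = Λ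
    rw [e.surjective.range_comp, Subtype.range_coe]
  have hsum : 1 < ∑ i, ρ i ^ r := by
    by_contra! hle
    have := F.dimH_range_le hc hq hq1 hr hle
    rw [hrange] at this
    exact absurd hdim (not_lt.2 this)
  obtain ⟨g, M, hM, hg, hV⟩ := _root_.exists_holder_nowhere_constant hc hr
    fun a b hab => F.exists_pos_le_chainCost hc hi hq hq1 hr hsum hab
  refine ⟨g ∘ e.symm, M, hM, fun x y => ?_, fun V hVo hVne => ?_⟩
  · simpa [Subtype.dist_eq] using hg (e.symm x) (e.symm y)
  · obtain ⟨s, hs, t, ht, hst⟩ := hV (e ⁻¹' V) (hVo.preimage e.continuous)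
      (hVne.preimage e.surjective)
    exact ⟨e s, hs, e t, ht, by simpa using hst⟩

/-- A connected set carries no non-constant function with a Hölder bound of order above its
Hausdorff dimension. -/
theorem le_of_mem_holderExponents {E : Set X} (hE : IsPreconnected E) {s : ℝ} (hs : 0 ≤ s)
    (hdim : dimH E = ENNReal.ofReal s) {r : ℝ} (hr : r ∈ holderExponents E) : r ≤ s := by
  obtain ⟨f, ⟨x, y, hxy⟩, M, hM, hf⟩ := hr
  rcases le_or_gt r 0 with h0 | h0
  · exact h0.trans hs
  have hH : HolderWith M.toNNReal r.toNNReal f := fun a b => by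
    rw [edist_dist, edist_dist, Real.coe_toNNReal r h0.le,
      ENNReal.ofReal_rpow_of_nonneg dist_nonneg h0.le, ENNReal.ofNNReal_toNNReal,
      ← ENNReal.ofReal_mul hM.le]
    exact ENNReal.ofReal_le_ofReal (hf a b)
  have hr0 : 0 < r.toNNReal := Real.toNNReal_pos.2 h0
  have := isPreconnected_iff_preconnectedSpace.1 hE
  -- The range is a non-degenerate interval, of dimension one, while the Hölder bound gives it
  -- dimension at most `s / r`.
  have hconn : (range f).OrdConnected := (isPreconnected_range (hH.continuous hr0)).ordConnected
  have hint : (interior (range f)).Nonempty := by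
    have key : ∀ x y, f x < f y → (interior (range f)).Nonempty := fun x y hlt => by
      refine (nonempty_Ioo.2 hlt).mono (interior_maximal ?_ isOpen_Ioo)
      exact Ioo_subset_Icc_self.trans (hconn.out (mem_range_self x) (mem_range_self y))
    rcases hxy.lt_or_gt with h1 | h1
    exacts [key x y h1, key y x h1]
  have h1 := hH.dimH_range_le hr0
  have huniv : dimH (univ : Set E) = dimH E := by
    rw [← isometry_subtype_coe.dimH_image, image_univ, Subtype.range_coe]
  rw [Real.dimH_of_nonempty_interior hint, huniv, hdim, Module.finrank_self, Nat.cast_one,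
    ENNReal.le_div_iff_mul_le (Or.inl (by simpa using h0)) (Or.inl ENNReal.coe_ne_top), one_mul,
    ENNReal.ofNNReal_toNNReal] at h1
  exact (ENNReal.ofReal_le_ofReal_iff hs).1 h1

end SelfSimilarArc

theorem theorem1 (N : ℕ) (Λ : Set (EuclideanSpace ℝ (Fin N))) (hΛ : IsSelfSimilarArc Λ)
    (s : ℝ) (hs : 1 < s) (hdim : dimH Λ = ENNReal.ofReal s) :
    IsStrictWhitneySet Λ ∧ criticality Λ = (s : EReal) := by
  have hs0 : 0 < s := one_pos.trans hs
  have hconn : IsConnected Λ := by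
    obtain ⟨e⟩ := hΛ.1
    have := isConnected_range (continuous_subtype_val.comp e.continuous)
    rwa [e.surjective.range_comp, Subtype.range_coe] at this
  have hlt : ∀ r, r < s → ENNReal.ofReal r < dimH Λ := fun r hr => by
    rw [hdim]
    exact (ENNReal.ofReal_lt_ofReal_iff hs0).2 hr
  refine ⟨⟨hconn, ?_⟩, le_antisymm (sSup_le ?_) (le_of_forall_lt fun c hc => ?_)⟩
  -- `r < s` provides the Hölder function, `1 < r` its `C¹` extension.
  · obtain ⟨r, hr1, hrs⟩ := exists_between hs
    obtain ⟨f, M, hM, hf, hV⟩ := hΛ.exists_holder_nowhere_constant (one_pos.trans hr1) (hlt r hrs)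
    have hext : ∀ x : Λ, extend Subtype.val f 0 (x : EuclideanSpace ℝ (Fin N)) = f x := fun x =>
      Subtype.val_injective.extend_apply f 0 x
    obtain ⟨F, hF, hFΛ⟩ := exists_contDiff_extension_fderiv_eq_zero hconn.nonempty
      (f := extend Subtype.val f 0) hM.le hr1 fun x hx y hy => by
        rw [hext ⟨x, hx⟩, hext ⟨y, hy⟩]
        exact hf ⟨x, hx⟩ ⟨y, hy⟩
    have hFf : ∀ x : Λ, F x = f x := fun x => by rw [(hFΛ x x.2).1, hext]
    have hopen : ∀ U : Set (EuclideanSpace ℝ (Fin N)), IsOpen U → (U ∩ Λ).Nonempty →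
        ∃ x ∈ U ∩ Λ, ∃ y ∈ U ∩ Λ, F x ≠ F y := by
      rintro U hU ⟨z, hzU, hzΛ⟩
      obtain ⟨x, hx, y, hy, hxy⟩ := hV (Subtype.val ⁻¹' U) (hU.preimage continuous_subtype_val)
        ⟨⟨z, hzΛ⟩, hzU⟩
      exact ⟨x, ⟨hx, x.2⟩, y, ⟨hy, y.2⟩, by rwa [hFf, hFf]⟩
    refine ⟨F, ⟨⟨hF, fun x hx => ?_, ?_⟩, hopen⟩⟩
    · rw [gradient, (hFΛ x hx).2, map_zero]
    · simpa using hopen univ isOpen_univ (by simpa using hconn.nonempty)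
  · rintro _ ⟨r, hr, rfl⟩
    exact EReal.coe_le_coe_iff.2 (le_of_mem_holderExponents hconn.isPreconnected hs0.le hdim hr)
  -- The maximum with zero keeps the exponent positive even when `c` is negative.
  · obtain ⟨r, hcr, hrs⟩ := EReal.lt_iff_exists_real_btwn.1 (max_lt hc (EReal.coe_lt_coe_iff.2 hs0))
    rw [max_lt_iff] at hcr
    have hr0 : 0 < r := EReal.coe_pos.1 hcr.2
    obtain ⟨f, M, hM, hf, hV⟩ :=
      hΛ.exists_holder_nowhere_constant hr0 (hlt r (EReal.coe_lt_coe_iff.1 hrs))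
    obtain ⟨z, hz⟩ := hconn.nonempty
    obtain ⟨x, -, y, -, hxy⟩ := hV univ isOpen_univ ⟨⟨z, hz⟩, mem_univ _⟩
    exact hcr.1.trans_le (le_sSup ⟨r, ⟨f, ⟨x, y, hxy⟩, M, hM, hf⟩, rfl⟩)
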